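/- \textbf{Definitions.} Monoids are commutative. In a partially ordered set in which increasing sequences have suprema, write $x\ll y$ if for every increasing sequence $(z_n)_n$ with $y\le\sup_n z_n$ there is $m$ with $x\le z_m$. A \emph{Cu-semigroup} is a positively ordered monoid $S$ (so $0\le x$ for all $x$, and addition is order preserving) such that: (O1) every increasing sequence has a supremum; (O2) every $x\in S$ is the supremum of a sequence $x_0\ll x_1\ll x_2\ll\cdots$; (O3) $x'\ll x$ and $y'\ll y$ imply $x'+y'\ll x+y$; (O4) $\sup_n(x_n+y_n)=\sup_n x_n+\sup_n y_n$ for increasing sequences $(x_n)_n,(y_n)_n$. Further axioms are: (O5) if $x+y\le z$, $x'\ll x$, $y'\ll y$, then there is $c$ with $y'\ll c$ and $x'+c\le z\le x+c$; (O6) if $x'\ll x\ll y+z$, then there are $v,w$ with $v\le x,y$, $w\le x,z$ and $x'\le v+w$; (O7) if $x'\ll x\le w$ and $y'\ll y\le w$, then there is $z$ with $x',y'\ll z\le w,\,x+y$. Put $\infty x=\sup_n nx$. An element $e$ is \emph{full} if $x\le\infty e$ for all $x\in S$. $S$ is \emph{$(2,\omega)$-divisible} if for all $x'\ll x$ there is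 $y$ with $2y\le x$ and $x'\le\infty y$. $S$ is \emph{countably based} if it has a countable subset $D$ such that every element of $S$ is the supremum of an increasing sequence in $D$. An element $x$ is \emph{strongly soft} if for every $x'\ll x$ there is $t$ with $x'+t\ll x$ and $x'\ll\infty t$; $S_{\rm soft}$ is the submonoid of strongly soft elements with the inherited order. $S$ is \emph{left-soft separative} if, for $x\in S_{\rm soft}$ and $y,t\in S$, the relations $x+t\ll y+t$, $t\ll\infty x$ and $t\ll\infty y$ imply $x\ll y$. $F(S)$ is the set of monoid morphisms $\lambda\colon S\to[0,\infty]$ that preserve order and suprema of increasing sequences, and $\widehat{x}\colon F(S)\to[0,\infty]$ is $\widehat{x}(\lambda)=\lambda(x)$. For a full element $e$ of a Cu-semigroup $S$, $\mathrm{rc}(S,e)\in[0,\infty]$ is the infimum of all real $r>0$ such that, for all $x,y\in S$, if $\lambda(x)+r\lambda(e)\le\lambda(y)$ for every $\lambda\in F(S)$, then $x\le y$ (and it is $\infty$ if there is no such $r$). \textbf{Theorem.} Let $S$ be a $(2,\omega)$-divisible Cu-semigroup satisfying (O5)--(O7), and let $e\in S$ be full. Then $S_{\rm soft}$ is a Cu-semigroup,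 and there exists $w\in S_{\rm soft}$, full in $S_{\rm soft}$, such that \[ \mathrm{rc}(S,e)=\mathrm{rc}(S_{\rm soft},w),\qquad w\le e\le\infty w,\qquad \widehat{e}=\widehat{w}. \] If $S$ is moreover countably based and left-soft separative, then the supremum \[ \sigma(e)=\sup\{u'\in S : u'\ll u\ll e\text{ for some }u\in S_{\rm soft}\} \] exists in $S$, is strongly soft, is full in $S_{\rm soft}$, and \[ \mathrm{rc}(S,e)=\mathrm{rc}(S_{\rm soft},\sigma(e)). \] -/

import Mathlib

open Set
open scoped ENNReal NNReal

namespace CuSgp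

section Order

variable {S : Type*}

/-- Sequential way-below relation: `x ≪ y` if for every increasing sequence `z` with a
supremum `s ≥ y` there is an index `m` with `x ≤ z m`. -/
def WayBelow [Preorder S] (x y : S) : Prop :=
  ∀ z : ℕ → S, Monotone z → ∀ s : S, IsLUB (range z) s → y ≤ s → ∃ m, x ≤ z m

/-- The supremum of a set. It is the least upper bound whenever one exists; the value `0`
otherwise is irrelevant. -/
noncomputable def lub [Preorder S] [Zero S] (A : Set S) : S :=
  open Classical in if h : ∃ s, IsLUB A s then h.choose else 0

theorem isLUB_lub [Preorder S] [Zero S] {A : Set S} (h : ∃ s, IsLUB A s) :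
    IsLUB A (lub A) := by
  unfold lub
  rw [dif_pos h]
  exact h.choose_spec

theorem WayBelow.le [Preorder S] {x y : S} (h : WayBelow x y) : x ≤ y := by
  obtain ⟨_, hm⟩ := h (fun _ => y) monotone_const y (by simp) le_rfl
  exact hm

theorem WayBelow.trans_le [Preorder S] {x y z : S} (h : WayBelow x y) (hyz : y ≤ z) : WayBelow x z :=
  fun u hu s hs hzs => h u hu s hs (hyz.trans hzs)

theorem WayBelow.of_le [Preorder S] {x y z : S} (hxy : x ≤ y) (h : WayBelow y z) : WayBelow x z :=
  fun u hu s hs hzs => (h u hu s hs hzs).imp fun _ hm => hxy.trans hm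

end Order

section Monoid

variable (S : Type*) [AddCommMonoid S] [PartialOrder S]

/-- `Cu`-semigroups: positively ordered (commutative) monoids satisfying (O1)-(O4). -/
class IsCuSemigroup : Prop extends IsOrderedAddMonoid S where
  nonneg : ∀ x : S, 0 ≤ x
  /-- (O1) -/
  exists_sup : ∀ u : ℕ → S, Monotone u → ∃ s, IsLUB (range u) s
  /-- (O2) -/
  exists_approx : ∀ x : S, ∃ u : ℕ → S, (∀ n, WayBelow (u n) (u (n + 1))) ∧ IsLUB (range u) x
  /-- (O3) -/
  wayBelow_add : ∀ x' x y' y : S, WayBelow x' x → WayBelow y' y → WayBelow (x' + y') (x + y)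
  /-- (O4) -/
  sup_add : ∀ u v : ℕ → S, Monotone u → Monotone v → ∀ a b : S,
    IsLUB (range u) a → IsLUB (range v) b → IsLUB (range fun n => u n + v n) (a + b)

/-- (O5) -/
def AxiomO5 : Prop :=
  ∀ x y x' y' z : S, x + y ≤ z → WayBelow x' x → WayBelow y' y →
    ∃ c : S, WayBelow y' c ∧ x' + c ≤ z ∧ z ≤ x + c

/-- (O6) -/
def AxiomO6 : Prop :=
  ∀ x x' y z : S, WayBelow x' x → WayBelow x (y + z) →
    ∃ v w : S, v ≤ x ∧ v ≤ y ∧ w ≤ x ∧ w ≤ z ∧ x' ≤ v + w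

/-- (O7) -/
def AxiomO7 : Prop :=
  ∀ x x' y y' w : S, WayBelow x' x → x ≤ w → WayBelow y' y → y ≤ w →
    ∃ z : S, WayBelow x' z ∧ WayBelow y' z ∧ z ≤ w ∧ z ≤ x + y

variable {S}

/-- `∞ x`, the supremum of the sequence of multiples of `x`. -/
noncomputable def infMul (x : S) : S := lub (range fun n : ℕ => n • x)

/-- `e` is full: every element of the semigroup lies below `∞ e`, that is, the ideal
generated by `e` is everything. -/
def IsFull (e : S) : Prop := ∀ x : S, x ≤ infMul e

/-- `x` is strongly soft. -/
def IsStronglySoft (x : S) : Prop :=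
  ∀ x' : S, WayBelow x' x → ∃ t : S, WayBelow (x' + t) x ∧ WayBelow x' (infMul t)

variable (S)

/-- `(2, ω)`-divisibility. -/
def IsTwoOmegaDivisible : Prop :=
  ∀ x' x : S, WayBelow x' x → ∃ y : S, 2 • y ≤ x ∧ x' ≤ infMul y

/-- Left-soft separativity. -/
def IsLeftSoftSeparative : Prop :=
  ∀ x y t : S, IsStronglySoft x → WayBelow (x + t) (y + t) →
    WayBelow t (infMul x) → WayBelow t (infMul y) → WayBelow x y

/-- A countable subset exists such that every element is the supremum of an increasing
sequence in it. -/
def IsCountablyBased : Prop :=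
  ∃ D : Set S, D.Countable ∧
    ∀ x : S, ∃ u : ℕ → S, Monotone u ∧ (∀ n, u n ∈ D) ∧ IsLUB (range u) x

/-- Functionals: monoid morphisms `S → [0, ∞]` that preserve the order and suprema of
increasing sequences. -/
structure Functional extends S →+ ℝ≥0∞ where
  monotone' : Monotone toFun
  isLUB_map' : ∀ u : ℕ → S, Monotone u → ∀ s : S, IsLUB (range u) s →
    IsLUB (range fun n => toFun (u n)) (toFun s)

instance : CoeFun (Functional S) (fun _ => S → ℝ≥0∞) := ⟨fun l => l.toFun⟩

variable {S}

/-- The rank of `x`, a function on the set of functionals. -/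
def rank (x : S) : Functional S → ℝ≥0∞ := fun l => l x

variable (S)

/-- Condition (R1) for `r`. -/
def CondR1 (e : S) (r : ℝ≥0) : Prop :=
  ∀ x y : S, (∀ l : Functional S, l x + (r : ℝ≥0∞) * l e ≤ l y) → x ≤ y

/-- The radius of comparison, an element of `[0, ∞]` (equal to `∞` if (R1) holds for no
positive real number). -/
noncomputable def rc (e : S) : ℝ≥0∞ :=
  sInf {a : ℝ≥0∞ | ∃ r : ℝ≥0, 0 < r ∧ CondR1 S e r ∧ a = (r : ℝ≥0∞)}

variable {S}

/-- The set `L_x` of all `u'` with `u' ≪ u ≪ x` for some strongly soft `u`. -/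
def softLower (x : S) : Set S :=
  {u' | ∃ u : S, IsStronglySoft u ∧ WayBelow u' u ∧ WayBelow u x}

/-- `σ(x)`, the supremum of `L_x`. -/
noncomputable def softPart (x : S) : S := lub (softLower x)

theorem monotone_nsmul [IsCuSemigroup S] (x : S) : Monotone fun n : ℕ => n • x :=
  fun _ _ h => nsmul_le_nsmul_left (IsCuSemigroup.nonneg x) h

theorem isLUB_infMul [IsCuSemigroup S] (x : S) :
    IsLUB (range fun n : ℕ => n • x) (infMul x) :=
  isLUB_lub (IsCuSemigroup.exists_sup _ (monotone_nsmul x))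

theorem infMul_add [IsCuSemigroup S] (x y : S) : infMul (x + y) = infMul x + infMul y := by
  have h := IsCuSemigroup.sup_add _ _ (monotone_nsmul x) (monotone_nsmul y) _ _
    (isLUB_infMul x) (isLUB_infMul y)
  simp only [← nsmul_add] at h
  exact (isLUB_infMul (x + y)).unique h

theorem wayBelow_zero [IsCuSemigroup S] (x : S) : WayBelow 0 x :=
  fun z _ _ _ _ => ⟨0, IsCuSemigroup.nonneg (z 0)⟩

theorem isStronglySoft_zero [IsCuSemigroup S] : IsStronglySoft (0 : S) := fun x' h => by
  have hx : x' = 0 := le_antisymm h.le (IsCuSemigroup.nonneg x')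
  subst hx
  exact ⟨0, by simpa using h, wayBelow_zero _⟩

theorem exists_wayBelow_add [IsCuSemigroup S] {z x y : S} (h : WayBelow z (x + y)) :
    ∃ x' y', WayBelow x' x ∧ WayBelow y' y ∧ z ≤ x' + y' := by
  obtain ⟨u, hu, hux⟩ := IsCuSemigroup.exists_approx x
  obtain ⟨v, hv, hvy⟩ := IsCuSemigroup.exists_approx y
  have mu : Monotone u := monotone_nat_of_le_succ fun n => (hu n).le
  have mv : Monotone v := monotone_nat_of_le_succ fun n => (hv n).le
  obtain ⟨m, hm⟩ := h _ (mu.add mv) _ (IsCuSemigroup.sup_add u v mu mv x y hux hvy) le_rfl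
  exact ⟨u m, v m, (hu m).trans_le (hux.1 ⟨m + 1, rfl⟩),
    (hv m).trans_le (hvy.1 ⟨m + 1, rfl⟩), hm⟩

theorem IsStronglySoft.add [IsCuSemigroup S] {x y : S} (hx : IsStronglySoft x)
    (hy : IsStronglySoft y) : IsStronglySoft (x + y) := by
  intro z hz
  obtain ⟨x', y', hx', hy', hle⟩ := exists_wayBelow_add hz
  obtain ⟨t, ht, ht'⟩ := hx x' hx'
  obtain ⟨s, hs, hs'⟩ := hy y' hy'
  refine ⟨t + s, ?_, ?_⟩
  · refine WayBelow.of_le ?_ (IsCuSemigroup.wayBelow_add _ _ _ _ ht hs)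
    rw [add_add_add_comm]
    exact add_le_add_left hle _
  · rw [infMul_add]
    exact WayBelow.of_le hle (IsCuSemigroup.wayBelow_add _ _ _ _ ht' hs')

variable (S)

/-- `S_soft`, the submonoid of strongly soft elements. As a type, it carries the inherited
addition and order. -/
def soft [IsCuSemigroup S] : AddSubmonoid S where
  carrier := {x | IsStronglySoft x}
  zero_mem' := isStronglySoft_zero
  add_mem' := IsStronglySoft.add

end Monoid

end CuSgp

/-! Everything rests on soft cores: strongly soft `w ≤ x` with `n • x ≤ (n + 1) • w` for all `n`.
Such `w` generates the same ideal as `x`, and no functional distinguishes the two. Divisibility and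
(O5)–(O7) give every element a core (`exists_soft_of_wayBelow`, `exists_isSoftCore`).

For a core `w` of `e`, the two radii agree. Functionals of `S` restrict to `S_soft`, giving one
inequality. Conversely, a functional on `S_soft` extends to `S` by evaluation on cores
(`Functional.exists_extension`). To compare arbitrary `x` and `y`, add to `x` a small strongly soft
full element, which makes it soft at a cost of at most `1/n` of `e`, and replace `y` by a core
(`IsSoftCore.condR1`).

Left-soft separativity makes `softLower e` upward directed (`exists_soft_upper_bound`), and a
countable base turns this into a supremum. It dominates every soft element below `e`, in particular
some core, so it is itself a core and the first part applies. -/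

namespace CuSgp

local infix:50 " ⋘ " => WayBelow

/-! ### Way-below relation and infinite multiples. -/

section Order

theorem WayBelow.trans {S : Type*} [Preorder S] {x y z : S} (h : x ⋘ y) (h' : y ⋘ z) : x ⋘ z :=
  h.trans_le h'.le

end Order

section Basic

variable {S : Type*} [AddCommMonoid S] [PartialOrder S] [IsCuSemigroup S]

theorem exists_rapid_seq (x : S) : ∃ u : ℕ → S, Monotone u ∧ (∀ n, u n ⋘ u (n + 1)) ∧
    (∀ n, u n ⋘ x) ∧ IsLUB (range u) x := by
  obtain ⟨u, hu, hux⟩ := IsCuSemigroup.exists_approx x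
  exact ⟨u, monotone_nat_of_le_succ fun n => (hu n).le, hu,
    fun n => (hu n).trans_le (hux.1 ⟨n + 1, rfl⟩), hux⟩

theorem WayBelow.exists_between {x y : S} (h : x ⋘ y) : ∃ z, x ⋘ z ∧ z ⋘ y := by
  obtain ⟨u, hm, hu, huy, hs⟩ := exists_rapid_seq y
  obtain ⟨n, hn⟩ := h u hm y hs le_rfl
  exact ⟨u (n + 1), .of_le hn (hu n), huy _⟩

/-- The index can be chosen such that `x` is even way below the member of the sequence. -/
theorem WayBelow.exists_index {x y : S} (h : x ⋘ y) {z : ℕ → S} (hz : Monotone z) {s : S}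
    (hs : IsLUB (range z) s) (hy : y ≤ s) : ∃ n, x ⋘ z n := by
  obtain ⟨a, hxa, hay⟩ := h.exists_between
  obtain ⟨n, hn⟩ := hay z hz s hs hy
  exact ⟨n, hxa.trans_le hn⟩

theorem le_of_forall_wayBelow {x y : S} (h : ∀ a, a ⋘ x → a ≤ y) : x ≤ y := by
  obtain ⟨u, _, _, hux, hs⟩ := exists_rapid_seq x
  exact hs.2 (by rintro _ ⟨n, rfl⟩; exact h _ (hux n))

theorem exists_wayBelow_join {a b x : S} (ha : a ⋘ x) (hb : b ⋘ x) :
    ∃ c, a ⋘ c ∧ b ⋘ c ∧ c ⋘ x := by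
  obtain ⟨u, hm, hu, hux, hs⟩ := exists_rapid_seq x
  obtain ⟨n, hn⟩ := ha.exists_index hm hs le_rfl
  obtain ⟨k, hk⟩ := hb.exists_index hm hs le_rfl
  exact ⟨u (max n k), hn.trans_le (hm (le_max_left _ _)), hk.trans_le (hm (le_max_right _ _)),
    hux _⟩

theorem WayBelow.add {a b x y : S} (h : a ⋘ x) (h' : b ⋘ y) : a + b ⋘ x + y :=
  IsCuSemigroup.wayBelow_add _ _ _ _ h h'

theorem WayBelow.nsmul {a x : S} (h : a ⋘ x) (n : ℕ) : n • a ⋘ n • x := by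
  induction n with
  | zero => simpa using wayBelow_zero (0 : S)
  | succ k ih => simpa only [succ_nsmul] using ih.add h

theorem isLUB_nsmul {u : ℕ → S} (hu : Monotone u) {x : S} (hx : IsLUB (range u) x) (n : ℕ) :
    IsLUB (range fun k => n • u k) (n • x) := by
  induction n with
  | zero => simp
  | succ k ih =>
    simp only [succ_nsmul]
    exact IsCuSemigroup.sup_add _ _ (fun i j h => nsmul_le_nsmul_right (hu h) k) hu _ _ ih hx

theorem WayBelow.exists_nsmul {a x : S} {n : ℕ} (h : a ⋘ n • x) :
    ∃ x', x' ⋘ x ∧ a ⋘ n • x' := by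
  obtain ⟨u, hm, hu, hux, hs⟩ := exists_rapid_seq x
  obtain ⟨k, hk⟩ := h.exists_index (fun i j h => nsmul_le_nsmul_right (hm h) n)
    (isLUB_nsmul hm hs n) le_rfl
  exact ⟨u k, hux k, hk⟩

theorem le_add_of_nonneg (x y : S) : x ≤ x + y := by
  simpa using add_le_add (le_refl x) (IsCuSemigroup.nonneg y)

theorem le_add_of_nonneg' (x y : S) : x ≤ y + x := by
  simpa using add_le_add (IsCuSemigroup.nonneg y) (le_refl x)

theorem nsmul_le_infMul (n : ℕ) (x : S) : n • x ≤ infMul x :=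
  (isLUB_infMul x).1 ⟨n, rfl⟩

theorem le_infMul_self (x : S) : x ≤ infMul x := by
  simpa using nsmul_le_infMul 1 x

theorem infMul_add_self_le (x : S) : infMul x + infMul x ≤ infMul x := by
  refine (IsCuSemigroup.sup_add _ _ (monotone_nsmul x) (monotone_nsmul x) _ _
    (isLUB_infMul x) (isLUB_infMul x)).2 ?_
  rintro _ ⟨n, rfl⟩
  simpa only [← add_nsmul] using nsmul_le_infMul (n + n) x

theorem add_le_infMul {a b y : S} (ha : a ≤ infMul y) (hb : b ≤ infMul y) :
    a + b ≤ infMul y :=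
  (add_le_add ha hb).trans (infMul_add_self_le y)

theorem nsmul_le_infMul_of_le {a y : S} (ha : a ≤ infMul y) (n : ℕ) : n • a ≤ infMul y := by
  induction n with
  | zero => simpa using IsCuSemigroup.nonneg _
  | succ k ih => simpa only [succ_nsmul] using add_le_infMul ih ha

theorem infMul_le {x y : S} (h : x ≤ infMul y) : infMul x ≤ infMul y := by
  refine (isLUB_infMul x).2 ?_
  rintro _ ⟨n, rfl⟩
  exact nsmul_le_infMul_of_le h n

theorem infMul_mono {x y : S} (h : x ≤ y) : infMul x ≤ infMul y :=
  infMul_le (h.trans (le_infMul_self y))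

theorem WayBelow.exists_le_nsmul {a c : S} (h : a ⋘ infMul c) : ∃ n : ℕ, a ⋘ n • c :=
  h.exists_index (monotone_nsmul c) (isLUB_infMul c) le_rfl

theorem WayBelow.exists_infMul {a c : S} (h : a ⋘ infMul c) :
    ∃ c', c' ⋘ c ∧ a ⋘ infMul c' := by
  obtain ⟨n, hn⟩ := h.exists_le_nsmul
  obtain ⟨c', hc', ha⟩ := hn.exists_nsmul
  exact ⟨c', hc', ha.trans_le (nsmul_le_infMul n c')⟩

theorem WayBelow.add_infMul {a b y : S} (ha : a ⋘ infMul y) (hb : b ⋘ infMul y) :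
    a + b ⋘ infMul y :=
  (ha.add hb).trans_le (infMul_add_self_le y)

theorem WayBelow.infMul_trans {a b y : S} (ha : a ⋘ infMul b) (hb : b ≤ infMul y) :
    a ⋘ infMul y :=
  ha.trans_le (infMul_le hb)

end Basic

/-! ### Permanence of strong softness. -/

section Soft

variable {S : Type*} [AddCommMonoid S] [PartialOrder S] [IsCuSemigroup S]

/-- A soft summand leaves room inside the sum; since it generates the ideal of `z`, that room serves
for `z` as well. -/
theorem IsStronglySoft.add_left_of_le_infMul {s z : S} (hs : IsStronglySoft s)
    (hz : z ≤ infMul s) : IsStronglySoft (z + s) := by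
  intro y hy
  obtain ⟨z', s', hz', hs', hle⟩ := exists_wayBelow_add hy
  obtain ⟨s₁, hs₁, hzs₁⟩ := (hz'.trans_le hz).exists_infMul
  obtain ⟨s₂, h1, h2, hs₂⟩ := exists_wayBelow_join hs' hs₁
  obtain ⟨t, ht, hst⟩ := hs s₂ hs₂
  have hle' : y ≤ z' + s₂ := hle.trans (add_le_add le_rfl h1.le)
  refine ⟨t, ?_, ?_⟩
  · refine .of_le (add_le_add hle' le_rfl) ?_
    rw [add_assoc]
    exact hz'.add ht
  · exact .of_le hle' ((hzs₁.infMul_trans (h2.le.trans hst.le)).add_infMul hst)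

theorem isStronglySoft_of_isLUB {u : ℕ → S} (hu : Monotone u) {x : S} (hx : IsLUB (range u) x)
    (h : ∀ n, ∃ v, u n ≤ v ∧ v ≤ x ∧ IsStronglySoft v) : IsStronglySoft x := by
  intro x' hx'
  obtain ⟨n, hn⟩ := hx'.exists_index hu hx le_rfl
  obtain ⟨v, huv, hvx, hv⟩ := h n
  obtain ⟨t, ht, ht'⟩ := hv x' (hn.trans_le huv)
  exact ⟨t, ht.trans_le hvx, ht'⟩

end Soft

/-! ### Small soft elements from divisibility. -/

section Divisible

variable {S : Type*} [AddCommMonoid S] [PartialOrder S] [IsCuSemigroup S]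

theorem IsTwoOmegaDivisible.exists_two (hdiv : IsTwoOmegaDivisible S) {a c : S}
    (h : a ⋘ infMul c) : ∃ y, 2 • y ≤ c ∧ a ⋘ infMul y := by
  obtain ⟨c', hc', ha⟩ := h.exists_infMul
  obtain ⟨y, hy, hc'y⟩ := hdiv c' c hc'
  exact ⟨y, hy, ha.infMul_trans hc'y⟩

theorem IsTwoOmegaDivisible.exists_nsmul (hdiv : IsTwoOmegaDivisible S) {a c : S}
    (h : a ⋘ infMul c) (n : ℕ) : ∃ y, n • y ≤ c ∧ a ⋘ infMul y := by
  suffices H : ∀ k : ℕ, ∃ y, 2 ^ k • y ≤ c ∧ a ⋘ infMul y by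
    obtain ⟨y, hy, hay⟩ := H n
    exact ⟨y, (nsmul_le_nsmul_left (IsCuSemigroup.nonneg y) Nat.lt_two_pow_self.le).trans hy, hay⟩
  intro k
  induction k with
  | zero => exact ⟨c, by simp, h⟩
  | succ k ih =>
    obtain ⟨y, hy, hay⟩ := ih
    obtain ⟨z, hz, haz⟩ := hdiv.exists_two hay
    refine ⟨z, ?_, haz⟩
    rw [pow_succ, mul_nsmul']
    exact (nsmul_le_nsmul_right hz _).trans hy

/-- Halve `c`. One half is divided further to give `y`; by (O5) the remainder `d` dominates a large
part of that half, so `d` still generates the ideal of `c`. -/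
theorem exists_split (hdiv : IsTwoOmegaDivisible S) (hO5 : AxiomO5 S) (n : ℕ) {a x c : S}
    (ha : a ⋘ x) (hc : x ≤ infMul c) :
    ∃ y d, n • y + d ≤ c ∧ x ≤ infMul d ∧ a ⋘ infMul y := by
  obtain ⟨y, hy, hay⟩ := hdiv.exists_two (ha.trans_le hc)
  obtain ⟨y₁, hy₁, hay₁⟩ := hay.exists_infMul
  obtain ⟨y₂, hy₁₂, hy₂⟩ := hy₁.exists_between
  obtain ⟨d, hd, hdc, hcd⟩ := hO5 y₂ y y₁ y₂ c
    ((add_le_add hy₂.le le_rfl).trans (by rwa [← two_nsmul])) hy₁₂ hy₂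
  obtain ⟨z, hz, haz⟩ := hdiv.exists_nsmul hay₁ n
  refine ⟨z, d, (add_le_add hz le_rfl).trans hdc, ?_, haz⟩
  refine hc.trans (infMul_le (hcd.trans (add_le_infMul ?_ (le_infMul_self d))))
  exact hd.le.trans (le_infMul_self d)

/-- Every element contains arbitrarily small strongly soft elements generating the same ideal. -/
theorem exists_soft_nsmul_le (hdiv : IsTwoOmegaDivisible S) (hO5 : AxiomO5 S) {n : ℕ}
    (hn : n ≠ 0) (x : S) :
    ∃ s, IsStronglySoft s ∧ n • s ≤ x ∧ x ≤ infMul s := by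
  obtain ⟨u, hum, -, hux, hu⟩ := exists_rapid_seq x
  choose! y d hyd hxd huy using fun (k : ℕ) (c : S) (hc : x ≤ infMul c) =>
    exists_split hdiv hO5 n (hux k) hc
  -- Split repeatedly: `c k` is what remains, `z k` the piece taken off, and `s` will be the sum of
  -- all pieces.
  let c : ℕ → S := fun k => Nat.rec x (fun k c => d k c) k
  have hc : ∀ k, x ≤ infMul (c k) := by
    intro k
    induction k with
    | zero => exact le_infMul_self x
    | succ k ih => exact hxd k (c k) ih
  let z : ℕ → S := fun k => y k (c k)
  let p : ℕ → S := fun k => ∑ i ∈ Finset.range k, z i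
  have hp : ∀ k, p (k + 1) = p k + z k := fun k => Finset.sum_range_succ _ _
  have hpm : Monotone p := monotone_nat_of_le_succ fun k => by
    rw [hp]; exact le_add_of_nonneg _ _
  have hpc : ∀ k, n • p k + c k ≤ x := by
    intro k
    induction k with
    | zero => simp [p, c]
    | succ k ih =>
      rw [hp, nsmul_add, add_assoc]
      exact (add_le_add le_rfl (hyd k (c k) (hc k))).trans ih
  obtain ⟨s, hs⟩ := IsCuSemigroup.exists_sup p hpm
  have hzs : ∀ k, z k ≤ s := fun k =>
    (le_add_of_nonneg' (z k) (p k)).trans ((hp k).symm.le.trans (hs.1 ⟨k + 1, rfl⟩))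
  have hnsx : n • s ≤ x := by
    refine (isLUB_nsmul hpm hs n).2 ?_
    rintro _ ⟨k, rfl⟩
    exact (le_add_of_nonneg _ _).trans (hpc k)
  have hxs : x ≤ infMul s := by
    refine hu.2 ?_
    rintro _ ⟨k, rfl⟩
    exact (huy k (c k) (hc k)).le.trans (infMul_mono (hzs k))
  refine ⟨s, ?_, hnsx, hxs⟩
  intro s' hs'
  obtain ⟨N, hN⟩ := hs'.exists_index hpm hs le_rfl
  have hsx : s ≤ x := by
    simpa using (nsmul_le_nsmul_left (IsCuSemigroup.nonneg s) (Nat.one_le_iff_ne_zero.2 hn)).trans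
      hnsx
  obtain ⟨M, hM⟩ := hs'.exists_index hum hu hsx
  -- A late piece generates `s'` and fits on top of the partial sum already above `s'`, so it
  -- contains the required witness.
  have hz : s' ⋘ infMul (z (max N M)) :=
    (hM.trans_le (hum (le_max_right N M))).trans (huy _ _ (hc _))
  obtain ⟨t, ht, hst⟩ := hz.exists_infMul
  refine ⟨t, ?_, hst⟩
  refine ((hN.trans_le (hpm (le_max_left N M))).add ht).trans_le ?_
  rw [← hp]
  exact hs.1 ⟨_, rfl⟩

end Divisible

/-! ### Existence of soft cores. -/

section SoftPart

variable {S : Type*} [AddCommMonoid S] [PartialOrder S] [IsCuSemigroup S]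

theorem IsStronglySoft.exists_complement (hO5 : AxiomO5 S) {u' u x : S} (hu : IsStronglySoft u)
    (hu' : u' ⋘ u) (hux : u ≤ x) : ∃ c, u' + c ≤ x ∧ x ≤ infMul c := by
  obtain ⟨v, huv, hv⟩ := hu'.exists_between
  obtain ⟨t, ht, hvt⟩ := hu v hv
  obtain ⟨t', ht', hvt'⟩ := hvt.exists_infMul
  obtain ⟨c, hc, huc, hxc⟩ := hO5 v t u' t' x (ht.le.trans hux) huv ht'
  exact ⟨c, huc, hxc.trans
    (add_le_infMul (hvt'.le.trans (infMul_mono hc.le)) (le_infMul_self c))⟩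

theorem IsStronglySoft.exists_between (hdiv : IsTwoOmegaDivisible S) (hO5 : AxiomO5 S) {a x : S}
    (hx : IsStronglySoft x) (ha : a ⋘ x) : ∃ u, IsStronglySoft u ∧ a ⋘ u ∧ u ⋘ x := by
  obtain ⟨b, hab, hbx⟩ := ha.exists_between
  obtain ⟨t, ht, hbt⟩ := hx b hbx
  obtain ⟨s, hs, hst, hts⟩ := exists_soft_nsmul_le hdiv hO5 one_ne_zero t
  rw [one_nsmul] at hst
  exact ⟨b + s, hs.add_left_of_le_infMul (hbt.le.trans (infMul_le hts)),
    hab.trans_le (le_add_of_nonneg _ _), .of_le (add_le_add le_rfl hst) ht⟩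

/-- Softness of `u` leaves room in `x` for `n + 1` copies of some `r` generating `x₃`. Give up one
copy: (O5) yields `c₁` still above `u₁ + n • r'`. By (O6), `x₁ ≤ p + q` with `p ≤ r'` and `q ≤ c₁`.
Now `u₁ + n • p` and `q` both lie below `c₁`, so (O7) joins them to `z`, which absorbs `n` copies of
`p'` at once: this is the extra copy in `n + 1`. The copy given up supplies a soft `s` that makes `z
+ s` soft. -/
theorem exists_soft_of_wayBelow (hdiv : IsTwoOmegaDivisible S) (hO5 : AxiomO5 S)
    (hO6 : AxiomO6 S) (hO7 : AxiomO7 S) {u u' x x' : S} (hu : IsStronglySoft u)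
    (hux : u ≤ x) (hu' : u' ⋘ u) (hx' : x' ⋘ x) (n : ℕ) :
    ∃ w, IsStronglySoft w ∧ w ≤ x ∧ u' ⋘ w ∧ n • x' ≤ (n + 1) • w := by
  obtain ⟨u₁, hu₁, hu₁u⟩ := hu'.exists_between
  obtain ⟨u₂, hu₁₂, hu₂⟩ := hu₁u.exists_between
  obtain ⟨c, huc, hxc⟩ := hu.exists_complement hO5 hu₂ hux
  obtain ⟨x₁, hx₁, hx₁x⟩ := hx'.exists_between
  obtain ⟨x₂, hx₁₂, hx₂x⟩ := hx₁x.exists_between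
  obtain ⟨x₃, hx₂₃, hux₃, hx₃⟩ := exists_wayBelow_join hx₂x (hu₁u.trans_le hux)
  obtain ⟨r, hrc, hxr⟩ := hdiv.exists_nsmul (hx₃.trans_le hxc) (n + 1)
  obtain ⟨r', hr', hxr'⟩ := hxr.exists_infMul
  obtain ⟨r'', hr'', hxr''⟩ := hxr'.exists_infMul
  obtain ⟨c₁, hc₁, hrx, hxrc⟩ := hO5 r' (u₂ + n • r) r'' (u₁ + n • r') x
    (by
      refine le_trans ?_ ((add_le_add le_rfl hrc).trans huc)
      rw [succ_nsmul, add_left_comm, add_comm (n • r)]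
      exact add_le_add le_rfl (add_le_add hr'.le le_rfl)) hr'' (hu₁₂.add (hr'.nsmul n))
  obtain ⟨p, q, hpx, hpr, hqx, hqc, hpq⟩ := hO6 x₂ x₁ r' c₁ hx₁₂ (hx₂x.trans_le hxrc)
  obtain ⟨p', q', hp', hq', hx'pq⟩ := exists_wayBelow_add (hx₁.trans_le hpq)
  obtain ⟨z, hz, hqz, hzc, hzle⟩ := hO7 (u₁ + n • p) (u' + n • p') q q' c₁
    (hu₁.add (hp'.nsmul n))
    ((add_le_add le_rfl (nsmul_le_nsmul_right hpr n)).trans hc₁.le) hq' hqc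
  have hx₂r : x₂ ≤ infMul r'' := hx₂₃.le.trans hxr''.le
  have hzr : z ≤ infMul r'' := hzle.trans <| add_le_infMul
    (add_le_infMul (hux₃.le.trans hxr''.le) (nsmul_le_infMul_of_le (hpx.trans hx₂r) n))
    (hqx.trans hx₂r)
  obtain ⟨s, hs, hsr, hrs⟩ := exists_soft_nsmul_le hdiv hO5 one_ne_zero r''
  rw [one_nsmul] at hsr
  refine ⟨z + s, hs.add_left_of_le_infMul (hzr.trans (infMul_le hrs)), ?_, ?_, ?_⟩
  · rw [add_comm z]
    exact (add_le_add hsr hzc).trans hrx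
  · exact .of_le (le_add_of_nonneg _ _) (hz.trans_le (le_add_of_nonneg _ _))
  · calc n • x' ≤ n • p' + n • q' := by
          rw [← nsmul_add]; exact nsmul_le_nsmul_right hx'pq n
      _ ≤ z + n • z :=
          add_le_add ((le_add_of_nonneg' _ _).trans hz.le) (nsmul_le_nsmul_right hqz.le n)
      _ = (n + 1) • z := by rw [succ_nsmul, add_comm]
      _ ≤ (n + 1) • (z + s) := nsmul_le_nsmul_right (le_add_of_nonneg _ _) _

/-- A strongly soft element `w ≤ x` that is as large as `x` up to any factor larger than one. -/
def IsSoftCore (w x : S) : Prop :=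
  IsStronglySoft w ∧ w ≤ x ∧ ∀ n : ℕ, n • x ≤ (n + 1) • w

theorem exists_isSoftCore (hdiv : IsTwoOmegaDivisible S) (hO5 : AxiomO5 S)
    (hO6 : AxiomO6 S) (hO7 : AxiomO7 S) (x : S) : ∃ w, IsSoftCore w x := by
  obtain ⟨a, ham, haa, hax, ha⟩ := exists_rapid_seq x
  -- Step `i` treats the pair `(n, k)` coded by `i`, securing `n • a k ≤ (n + 1) • v'`. Keeping `v`
  -- way below a soft element allows the next step; the soft elements interleaved between terms make
  -- the limit soft.
  have step : ∀ (i : ℕ) (v : {v : S // ∃ u, IsStronglySoft u ∧ u ≤ x ∧ v ⋘ u}),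
      ∃ v' : {v : S // ∃ u, IsStronglySoft u ∧ u ≤ x ∧ v ⋘ u},
        (∃ u, IsStronglySoft u ∧ (v : S) ≤ u ∧ u ≤ (v' : S)) ∧
        i.unpair.1 • a i.unpair.2 ≤ (i.unpair.1 + 1) • (v' : S) := by
    rintro i ⟨u', u, hu, hux, hu'⟩
    obtain ⟨w, hw, hwx, hu'w, hn⟩ :=
      exists_soft_of_wayBelow hdiv hO5 hO6 hO7 hu hux hu' (hax (i.unpair.2 + 1)) i.unpair.1
    obtain ⟨v₁, hv₁, huv₁, hv₁w⟩ := hw.exists_between hdiv hO5 hu'w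
    obtain ⟨w', hw', hnw'⟩ := (((haa i.unpair.2).nsmul i.unpair.1).trans_le hn).exists_nsmul
    obtain ⟨v, hv₁v, hw'v, hvw⟩ := exists_wayBelow_join hv₁w hw'
    exact ⟨⟨v, w, hw, hwx, hvw⟩, ⟨v₁, hv₁, huv₁.le, hv₁v.le⟩,
      hnw'.le.trans (nsmul_le_nsmul_right hw'v.le _)⟩
  choose f hf hfn using step
  let v : ℕ → {v : S // ∃ u, IsStronglySoft u ∧ u ≤ x ∧ v ⋘ u} := fun k =>
    Nat.rec ⟨0, 0, isStronglySoft_zero, IsCuSemigroup.nonneg x, wayBelow_zero 0⟩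
      (fun i v => f i v) k
  have hv : ∀ i, v (i + 1) = f i (v i) := fun i => rfl
  have hvm : Monotone fun i => (v i).1 := monotone_nat_of_le_succ fun i => by
    obtain ⟨u, -, h1, h2⟩ := hf i (v i)
    exact h1.trans h2
  obtain ⟨w, hw⟩ := IsCuSemigroup.exists_sup _ hvm
  refine ⟨w, ?_, ?_, fun n => ?_⟩
  · refine isStronglySoft_of_isLUB hvm hw fun i => ?_
    obtain ⟨u, hu, h1, h2⟩ := hf i (v i)
    exact ⟨u, h1, h2.trans (hw.1 ⟨i + 1, rfl⟩), hu⟩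
  · refine hw.2 ?_
    rintro _ ⟨i, rfl⟩
    obtain ⟨u, -, hux, hvu⟩ := (v i).2
    exact hvu.le.trans hux
  · refine (isLUB_nsmul ham ha n).2 ?_
    rintro _ ⟨k, rfl⟩
    have h := hfn (Nat.pair n k) (v (Nat.pair n k))
    rw [Nat.unpair_pair] at h
    exact h.trans (nsmul_le_nsmul_right (hw.1 ⟨Nat.pair n k + 1, rfl⟩) _)

theorem IsSoftCore.add {v w x y : S} (hv : IsSoftCore v x) (hw : IsSoftCore w y) :
    IsSoftCore (v + w) (x + y) :=
  ⟨hv.1.add hw.1, add_le_add hv.2.1 hw.2.1, fun n => by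
    simpa only [nsmul_add] using add_le_add (hv.2.2 n) (hw.2.2 n)⟩

theorem IsStronglySoft.isSoftCore_self {x : S} (hx : IsStronglySoft x) : IsSoftCore x x :=
  ⟨hx, le_rfl, fun _ => nsmul_le_nsmul_left (IsCuSemigroup.nonneg x) (Nat.le_succ _)⟩

theorem IsSoftCore.le_infMul {w x : S} (hw : IsSoftCore w x) : x ≤ infMul w := by
  simpa using (hw.2.2 1).trans (nsmul_le_infMul _ w)

end SoftPart

/-! ### The Cu-semigroup of strongly soft elements. -/

section SoftSubmonoid

variable {S : Type*} [AddCommMonoid S] [PartialOrder S] [IsCuSemigroup S]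

theorem exists_isLUB_soft {u : ℕ → soft S} (hu : Monotone u) :
    ∃ s : soft S, IsLUB (range fun n => (u n : S)) s := by
  have hm : Monotone fun n => (u n : S) := fun i j h => hu h
  obtain ⟨s, hs⟩ := IsCuSemigroup.exists_sup _ hm
  exact ⟨⟨s, isStronglySoft_of_isLUB hm hs fun n => ⟨u n, le_rfl, hs.1 ⟨n, rfl⟩, (u n).2⟩⟩, hs⟩

theorem isLUB_soft_of_coe {u : ℕ → soft S} {s : soft S}
    (h : IsLUB (range fun n => (u n : S)) s) : IsLUB (range u) s :=
  ⟨by rintro _ ⟨n, rfl⟩; exact h.1 ⟨n, rfl⟩,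
    fun t ht => h.2 (by rintro _ ⟨n, rfl⟩; exact ht ⟨n, rfl⟩)⟩

theorem isLUB_coe_soft {u : ℕ → soft S} (hu : Monotone u) {s : soft S} (h : IsLUB (range u) s) :
    IsLUB (range fun n => (u n : S)) s := by
  obtain ⟨t, ht⟩ := exists_isLUB_soft hu
  rwa [h.unique (isLUB_soft_of_coe ht)]

theorem WayBelow.soft_of_coe {x y : soft S} (h : (x : S) ⋘ y) : x ⋘ y := fun z hz s hs hys =>
  h (fun n => z n) (fun _ _ hij => hz hij) s (isLUB_coe_soft hz hs) hys

theorem exists_soft_rapid_seq (hdiv : IsTwoOmegaDivisible S) (hO5 : AxiomO5 S) (x : soft S) :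
    ∃ u : ℕ → soft S, Monotone u ∧ (∀ n, (u n : S) ⋘ u (n + 1)) ∧
      IsLUB (range fun n => (u n : S)) x := by
  obtain ⟨a, ham, haa, hax, ha⟩ := exists_rapid_seq (x : S)
  have step : ∀ (i : ℕ) (v : {v : soft S // (v : S) ⋘ x}),
      ∃ v' : {v : soft S // (v : S) ⋘ x}, (v.1 : S) ⋘ v'.1 ∧ a i ≤ v'.1 := by
    rintro i ⟨v, hv⟩
    obtain ⟨b, hvb, hab, hbx⟩ := exists_wayBelow_join hv (hax i)
    obtain ⟨w, hw, hbw, hwx⟩ := IsStronglySoft.exists_between hdiv hO5 x.2 hbx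
    exact ⟨⟨⟨w, hw⟩, hwx⟩, hvb.trans hbw, (hab.trans hbw).le⟩
  choose f hf hfa using step
  let v : ℕ → {v : soft S // (v : S) ⋘ x} := fun k =>
    Nat.rec ⟨0, wayBelow_zero _⟩ (fun i v => f i v) k
  refine ⟨fun n => (v n).1, monotone_nat_of_le_succ fun n => (hf n (v n)).le,
    fun n => hf n (v n), ?_, fun t ht => ha.2 ?_⟩
  · rintro _ ⟨n, rfl⟩
    exact (v n).2.le
  · rintro _ ⟨n, rfl⟩
    exact (hfa n (v n)).trans (ht ⟨n + 1, rfl⟩)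

/-- Test against a sequence of soft elements that is rapidly increasing in `S`; suprema in `soft S`
are those of `S`. -/
theorem WayBelow.coe_soft (hdiv : IsTwoOmegaDivisible S) (hO5 : AxiomO5 S) {x y : soft S}
    (h : x ⋘ y) : (x : S) ⋘ y := by
  obtain ⟨u, hu, huu, hs⟩ := exists_soft_rapid_seq hdiv hO5 y
  obtain ⟨n, hn⟩ := h u hu y (isLUB_soft_of_coe hs) le_rfl
  exact .of_le hn ((huu n).trans_le (hs.1 ⟨n + 1, rfl⟩))

theorem isCuSemigroup_soft (hdiv : IsTwoOmegaDivisible S) (hO5 : AxiomO5 S) :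
    IsCuSemigroup (soft S) where
  add_le_add_left a b h c := add_le_add (show (a : S) ≤ b from h) (le_refl (c : S))
  nonneg x := IsCuSemigroup.nonneg (x : S)
  exists_sup u hu := (exists_isLUB_soft hu).imp fun _ => isLUB_soft_of_coe
  exists_approx x := by
    obtain ⟨u, -, huu, hs⟩ := exists_soft_rapid_seq hdiv hO5 x
    exact ⟨u, fun n => (huu n).soft_of_coe, isLUB_soft_of_coe hs⟩
  wayBelow_add _ _ _ _ h h' :=
    WayBelow.soft_of_coe ((h.coe_soft hdiv hO5).add (h'.coe_soft hdiv hO5))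
  sup_add u v hu hv a b ha hb := isLUB_soft_of_coe <|
    IsCuSemigroup.sup_add (fun n => (u n : S)) (fun n => (v n : S)) (fun _ _ h => hu h)
      (fun _ _ h => hv h) a b (isLUB_coe_soft hu ha) (isLUB_coe_soft hv hb)

theorem isFull_soft {w : soft S} {e : S} (hsoft : IsCuSemigroup (soft S)) (he : IsFull e)
    (hw : e ≤ infMul (w : S)) : IsFull w := by
  intro x
  have h := isLUB_coe_soft (monotone_nsmul w) (isLUB_infMul w)
  have h' : IsLUB (range fun n : ℕ => n • (w : S)) (infMul w : soft S) := by simpa using h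
  have : (x : S) ≤ infMul (w : S) := (he x).trans (infMul_le hw)
  rwa [(isLUB_infMul (w : S)).unique h'] at this

end SoftSubmonoid

/-! ### Functionals and radii of comparison. -/

section Functionals

variable {S : Type*} [AddCommMonoid S] [PartialOrder S] [IsCuSemigroup S]

theorem _root_.ENNReal.le_of_forall_nat_mul_le {a b : ℝ≥0∞}
    (h : ∀ n : ℕ, n * a ≤ (n + 1 : ℕ) * b) : a ≤ b := by
  by_contra! hlt
  obtain ⟨c, hbc, hca⟩ := ENNReal.lt_iff_exists_nnreal_btwn.1 hlt
  lift b to ℝ≥0 using (hbc.trans ENNReal.coe_lt_top).ne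
  have hbc' : (b : ℝ) < c := by exact_mod_cast hbc
  obtain ⟨n, hn⟩ := exists_nat_gt ((b : ℝ) / (c - b))
  rw [div_lt_iff₀ (sub_pos.2 hbc')] at hn
  have h1 : (n : ℝ≥0∞) * c ≤ (n + 1 : ℕ) * (b : ℝ≥0∞) :=
    (mul_le_mul_right hca.le _).trans (h n)
  have h2 : (n : ℝ) * c ≤ (n + 1 : ℕ) * (b : ℝ) := by exact_mod_cast h1
  push_cast at h2
  linarith

theorem Functional.map_add {S : Type*} [AddCommMonoid S] [PartialOrder S] (l : Functional S)
    (x y : S) : l (x + y) = l x + l y :=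
  l.map_add' x y

theorem Functional.map_nsmul {S : Type*} [AddCommMonoid S] [PartialOrder S] (l : Functional S)
    (n : ℕ) (x : S) : l (n • x) = n * l x := by
  rw [← nsmul_eq_mul]
  exact _root_.map_nsmul l.toAddMonoidHom n x

theorem Functional.map_le_map_of_nsmul_le {S : Type*} [AddCommMonoid S] [PartialOrder S]
    (l : Functional S) {x y : S} (h : ∀ n : ℕ, n • x ≤ (n + 1) • y) : l x ≤ l y :=
  ENNReal.le_of_forall_nat_mul_le fun n => by
    simpa only [l.map_nsmul] using l.monotone' (h n)

theorem IsSoftCore.map_eq {S : Type*} [AddCommMonoid S] [PartialOrder S] {w x : S} (hw : IsSoftCore w x) (l : Functional S) :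
    l w = l x :=
  le_antisymm (l.monotone' hw.2.1) (l.map_le_map_of_nsmul_le hw.2.2)

/-- Although `z` need not be soft, `n • v ≤ n • z ≤ (n + 1) • w` compares soft elements. Hence the
value of `μ` on a core of `z` is independent of the core and monotone in `z`. -/
theorem IsSoftCore.map_le_soft {w v : soft S} {z : S} (hw : IsSoftCore (w : S) z)
    (hv : (v : S) ≤ z) (μ : Functional (soft S)) : μ v ≤ μ w :=
  μ.map_le_map_of_nsmul_le fun n => (nsmul_le_nsmul_right hv n).trans (hw.2.2 n)

/-- The restriction of a functional to the strongly soft elements. -/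
def Functional.restrict (l : Functional S) : Functional (soft S) where
  toAddMonoidHom := l.toAddMonoidHom.comp (soft S).subtype
  monotone' _ _ h := l.monotone' h
  isLUB_map' u hu s hs := l.isLUB_map' (fun n => (u n : S)) (fun _ _ h => hu h) s
    (isLUB_coe_soft hu hs)

theorem Functional.exists_extension (hdiv : IsTwoOmegaDivisible S) (hO5 : AxiomO5 S)
    (hO6 : AxiomO6 S) (hO7 : AxiomO7 S) (μ : Functional (soft S)) :
    ∃ l : Functional S, ∀ (w : soft S) (x : S), IsSoftCore (w : S) x → l x = μ w := by
  have hex : ∀ x : S, ∃ w : soft S, IsSoftCore (w : S) x := fun x =>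
    (exists_isSoftCore hdiv hO5 hO6 hO7 x).elim fun w hw => ⟨⟨w, hw.1⟩, hw⟩
  choose w hw using hex
  have heq : ∀ (v : soft S) (x : S), IsSoftCore (v : S) x → μ (w x) = μ v := fun v x hv =>
    le_antisymm (hv.map_le_soft (hw x).2.1 μ) ((hw x).map_le_soft hv.2.1 μ)
  have hmono : Monotone fun x => μ (w x) := fun x y hxy =>
    (hw y).map_le_soft ((hw x).2.1.trans hxy) μ
  refine ⟨{ toFun := fun x => μ (w x)
            map_zero' := (heq 0 0 isStronglySoft_zero.isSoftCore_self).trans μ.map_zero'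
            map_add' := fun x y =>
              (heq (w x + w y) (x + y) ((hw x).add (hw y))).trans (μ.map_add _ _)
            monotone' := hmono
            isLUB_map' := ?_ }, fun v x hv => heq v x hv⟩
  intro u hu s hs
  refine ⟨by rintro _ ⟨n, rfl⟩; exact hmono (hs.1 ⟨n, rfl⟩), fun b hb => ?_⟩
  obtain ⟨v, hv, hvv, hvs⟩ := exists_soft_rapid_seq hdiv hO5 (w s)
  refine (μ.isLUB_map' v hv _ (isLUB_soft_of_coe hvs)).2 ?_
  rintro _ ⟨n, rfl⟩
  -- Cores chosen for the `u m` need not be increasing. Instead, approximants of the core of `s`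
  -- fall below some `u m`, hence are dominated by its core under `μ`.
  obtain ⟨m, hm⟩ := ((hvv n).trans_le (hvs.1 ⟨n + 1, rfl⟩)) u hu s hs (hw s).2.1
  exact ((hw (u m)).map_le_soft hm μ).trans (hb ⟨m, rfl⟩)

theorem IsSoftCore.condR1 (hdiv : IsTwoOmegaDivisible S) (hO5 : AxiomO5 S)
    (hO6 : AxiomO6 S) (hO7 : AxiomO7 S) {w : soft S} {e : S} (he : IsFull e)
    (hw : IsSoftCore (w : S) e) {r r' : ℝ≥0} (hr : CondR1 (soft S) w r) (hrr' : r < r') :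
    CondR1 S e r' := by
  intro x y hxy
  -- The slack `r' - r` pays for the `s` below, since `n • s ≤ e` gives `l s ≤ l e / n`.
  obtain ⟨n, hn0, hn⟩ : ∃ n : ℕ, n ≠ 0 ∧ (n : ℝ≥0)⁻¹ + r ≤ r' := by
    obtain ⟨n, hn⟩ := exists_nat_one_div_lt (tsub_pos_of_lt hrr')
    refine ⟨n + 1, n.succ_ne_zero, ?_⟩
    rw [one_div] at hn
    exact_mod_cast (lt_tsub_iff_right.1 hn).le
  obtain ⟨s, hs, hse, hes⟩ := exists_soft_nsmul_le hdiv hO5 hn0 e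
  obtain ⟨v, hv⟩ := exists_isSoftCore hdiv hO5 hO6 hO7 y
  have hxs := hs.add_left_of_le_infMul ((he x).trans (infMul_le hes))
  refine (le_add_of_nonneg x s).trans (le_trans ?_ hv.2.1)
  refine hr ⟨x + s, hxs⟩ ⟨v, hv.1⟩ fun μ => ?_
  obtain ⟨l, hl⟩ := μ.exists_extension hdiv hO5 hO6 hO7
  rw [← hl ⟨x + s, hxs⟩ (x + s) hxs.isSoftCore_self, ← hl w e hw, ← hl ⟨v, hv.1⟩ y hv]
  refine le_trans ?_ (hxy l)
  rw [l.map_add, add_assoc]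
  refine add_le_add le_rfl ?_
  have h1 : (n : ℝ≥0∞) * l s ≤ l e := by
    rw [← l.map_nsmul]
    exact l.monotone' hse
  have h2 : l s ≤ ((n : ℝ≥0)⁻¹ : ℝ≥0) * l e := by
    rw [ENNReal.coe_inv (by exact_mod_cast hn0), ENNReal.coe_natCast,
      ← ENNReal.mul_le_iff_le_inv (by exact_mod_cast hn0) (ENNReal.natCast_ne_top n)]
    exact h1
  refine (add_le_add h2 le_rfl).trans ?_
  rw [← add_mul]
  exact mul_le_mul_left (by exact_mod_cast hn) _

theorem IsSoftCore.rc_eq (hdiv : IsTwoOmegaDivisible S) (hO5 : AxiomO5 S)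
    (hO6 : AxiomO6 S) (hO7 : AxiomO7 S) {w : soft S} {e : S} (he : IsFull e)
    (hw : IsSoftCore (w : S) e) : rc S e = rc (soft S) w := by
  refine le_antisymm (le_sInf ?_) (sInf_le_sInf ?_)
  · rintro _ ⟨r, hr0, hr, rfl⟩
    refine ENNReal.le_of_forall_pos_le_add fun ε hε _ => ?_
    exact sInf_le ⟨r + ε, add_pos hr0 hε,
      hw.condR1 hdiv hO5 hO6 hO7 he hr (lt_add_of_pos_right r hε), by push_cast; rfl⟩
  · rintro _ ⟨r, hr0, hr, rfl⟩
    refine ⟨r, hr0, fun x y hxy => hr x y fun l => ?_, rfl⟩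
    rw [← hw.map_eq l]
    exact hxy l.restrict

end Functionals

/-! ### Directedness of `softLower` and its supremum. -/

section Directed

variable {S : Type*} [AddCommMonoid S] [PartialOrder S] [IsCuSemigroup S]

/-- (O6) distributes `p` over the copies of `c`; (O7) merges the pieces again below a single `c`. -/
theorem exists_le_of_wayBelow_nsmul (hO6 : AxiomO6 S) (hO7 : AxiomO7 S) (n : ℕ) {p p' c : S}
    (hp : p' ⋘ p) (hpc : p ⋘ n • c) : ∃ z, z ≤ c ∧ z ≤ n • p ∧ p' ≤ n • z := by
  induction n generalizing p p' with
  | zero =>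
    refine ⟨0, IsCuSemigroup.nonneg c, IsCuSemigroup.nonneg _, ?_⟩
    simpa using hp.le.trans hpc.le
  | succ n ih =>
    obtain ⟨p₁, hp₁, hp₁p⟩ := hp.exists_between
    rw [succ_nsmul] at hpc
    obtain ⟨v, w, hvp, hvc, hwp, hwc, hvw⟩ := hO6 p p₁ (n • c) c hp₁p hpc
    obtain ⟨v', w', hv', hw', hpvw⟩ := exists_wayBelow_add (hp₁.trans_le hvw)
    obtain ⟨v₁, hv'₁, hv₁⟩ := hv'.exists_between
    obtain ⟨v₂, hv₁₂, hv₂⟩ := hv₁.exists_between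
    obtain ⟨z₁, hz₁c, hz₁v, hvz₁⟩ := ih hv₁₂ (hv₂.trans_le hvc)
    obtain ⟨z₁', hz₁', hvz₁'⟩ := (hv'₁.trans_le hvz₁).exists_nsmul
    obtain ⟨z, h1, h2, hzc, hz⟩ := hO7 z₁ z₁' w w' c hz₁' hz₁c hw' hwc
    refine ⟨z, hzc, ?_, ?_⟩
    · rw [succ_nsmul]
      exact hz.trans (add_le_add (hz₁v.trans (nsmul_le_nsmul_right (hv₂.le.trans hvp) n)) hwp)
    · rw [succ_nsmul]
      exact hpvw.trans
        (add_le_add (hvz₁'.le.trans (nsmul_le_nsmul_right h1.le n)) h2.le)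

/-- A common lower bound of `t` and `c` which generates almost the same ideal as `t`. -/
theorem exists_le_le_infMul (hdiv : IsTwoOmegaDivisible S) (hO6 : AxiomO6 S) (hO7 : AxiomO7 S)
    {a t c : S} (ht : t ⋘ infMul c) (ha : a ⋘ infMul t) :
    ∃ z, z ≤ t ∧ z ≤ c ∧ a ⋘ infMul z := by
  obtain ⟨n, hn⟩ := ht.exists_le_nsmul
  -- Division by `n + 1` compensates for the bound `z ≤ (n + 1) • p`; using `n + 1` instead of `n`
  -- ensures `p ≤ t`.
  obtain ⟨p, hpt, hap⟩ := hdiv.exists_nsmul ha (n + 1)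
  obtain ⟨p', hp', hap'⟩ := hap.exists_infMul
  have hpt' : p ≤ t := by
    refine le_trans ?_ hpt
    rw [succ_nsmul]
    exact le_add_of_nonneg' _ _
  have hpc : p ⋘ (n + 1) • c := .of_le hpt' <| hn.trans_le <|
    nsmul_le_nsmul_left (IsCuSemigroup.nonneg c) n.le_succ
  obtain ⟨z, hzc, hzp, hpz⟩ := exists_le_of_wayBelow_nsmul hO6 hO7 (n + 1) hp' hpc
  exact ⟨z, hzp.trans hpt, hzc, hap'.infMul_trans (hpz.trans (nsmul_le_infMul _ z))⟩

/-- (O7) joins elements only below a common bound, and room must remain to make the join soft. So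
reserve `r₁` and join inside a complement `c₁` from (O5). That `c₁` contains `u₂` by construction;
that it contains `v₂` is where separativity enters. -/
theorem exists_soft_upper_bound (hdiv : IsTwoOmegaDivisible S) (hO5 : AxiomO5 S)
    (hO6 : AxiomO6 S) (hO7 : AxiomO7 S) (hsep : IsLeftSoftSeparative S) {u' u v' v x : S}
    (hu : IsStronglySoft u) (hv : IsStronglySoft v) (hu' : u' ⋘ u) (hv' : v' ⋘ v)
    (hux : u ⋘ x) (hvx : v ≤ x) : ∃ w, IsStronglySoft w ∧ w ≤ x ∧ u' ⋘ w ∧ v' ⋘ w := by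
  obtain ⟨u₂, hu₂, hu₂u⟩ := hu'.exists_between
  obtain ⟨u₃, hu₂₃, hu₃⟩ := hu₂u.exists_between
  -- Enlarge `v` such that `u` lies in the ideal it generates.
  obtain ⟨v₁, hv₁, hv₁x, hv'₁, huv₁⟩ :=
    exists_soft_of_wayBelow hdiv hO5 hO6 hO7 hv hvx hv' hux 1
  rw [one_nsmul] at huv₁
  obtain ⟨a, ha, hua⟩ := (hu₃.trans_le huv₁).exists_nsmul
  obtain ⟨b, hv'b, hab, hb⟩ := exists_wayBelow_join hv'₁ ha
  obtain ⟨v₂, hv₂, hbv₂, hv₂₁⟩ := hv₁.exists_between hdiv hO5 hb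
  have huv₂ : u₃ ⋘ infMul v₂ :=
    hua.trans_le (nsmul_le_infMul_of_le ((hab.trans hbv₂).le.trans (le_infMul_self v₂)) _)
  obtain ⟨d, hd, hud⟩ := huv₂.exists_infMul
  obtain ⟨v₃, hdv₃, hv'₃, hv₃⟩ := exists_wayBelow_join hd (hv'b.trans hbv₂)
  have huv₃ : u₃ ⋘ infMul v₃ := hud.trans_le (infMul_mono hdv₃.le)
  -- Find room `r` next to both `u₃` and `v₂`.
  obtain ⟨t, ht, hvt⟩ := hv₁ v₂ hv₂₁
  obtain ⟨z, hzv, hzt, hv₃z⟩ :=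
    exists_le_le_infMul hdiv hO6 hO7 hvt (hv₃.trans_le (le_infMul_self v₂))
  obtain ⟨c, huc, hxc⟩ := hu.exists_complement hO5 hu₃ hux.le
  obtain ⟨z', hz', hv₃z'⟩ := hv₃z.exists_infMul
  have hzx : z ≤ x := hzv.trans (hv₂₁.le.trans hv₁x)
  obtain ⟨y, hyc, hzy⟩ := hdiv.exists_two (hz'.trans_le (hzx.trans hxc))
  obtain ⟨r, hrz, hry, hv₃r⟩ := exists_le_le_infMul hdiv hO6 hO7 hzy hv₃z'
  obtain ⟨r₂, hr₂, hv₃r₂⟩ := hv₃r.exists_infMul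
  obtain ⟨r₁, hr₁, hv₃r₁⟩ := hv₃r₂.exists_infMul
  have hroom : r₂ + (u₃ + r) ≤ x := by
    refine le_trans ?_ ((add_le_add le_rfl hyc).trans huc)
    rw [two_nsmul, add_left_comm]
    exact add_le_add le_rfl (add_le_add (hr₂.le.trans hry) hry)
  obtain ⟨c₁, hc₁, hrx, hxrc⟩ := hO5 r₂ (u₃ + r) r₁ (u₂ + r₂) x hroom hr₁ (hu₂₃.add hr₂)
  -- Cancel `r₂` from `v₂ + r₂ ≪ c₁ + r₂`: softness left `t ≥ r₂` beside `v₂` in `v₁`, and `v₁ ≤ x ≤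
  -- r₂ + c₁`.
  have hv₂c₁ : v₂ ⋘ c₁ := by
    refine hsep v₂ c₁ r₂ hv₂ ?_ ?_ ?_
    · rw [add_comm c₁]
      exact .of_le (add_le_add le_rfl (hr₂.le.trans (hrz.trans (hz'.le.trans hzt))))
        (ht.trans_le (hv₁x.trans hxrc))
    · exact hr₂.trans_le (hrz.trans (hz'.le.trans (hzv.trans (le_infMul_self v₂))))
    · exact .of_le (le_add_of_nonneg' r₂ u₂) (hc₁.trans_le (le_infMul_self c₁))
  obtain ⟨q, huq, hvq, hqc, hq⟩ := hO7 u₂ u' v₃ v' c₁ hu₂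
    ((le_add_of_nonneg u₂ r₂).trans hc₁.le) hv'₃ (hv₃.trans hv₂c₁).le
  have hqr : q ≤ infMul r₁ :=
    hq.trans (add_le_infMul (hu₂₃.le.trans (huv₃.infMul_trans hv₃r₁.le).le) hv₃r₁.le)
  obtain ⟨s, hs, hsr, hrs⟩ := exists_soft_nsmul_le hdiv hO5 one_ne_zero r₁
  rw [one_nsmul] at hsr
  refine ⟨q + s, hs.add_left_of_le_infMul (hqr.trans (infMul_le hrs)), ?_,
    huq.trans_le (le_add_of_nonneg q s), hvq.trans_le (le_add_of_nonneg q s)⟩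
  rw [add_comm q]
  exact (add_le_add hsr hqc).trans hrx

theorem exists_upper_bound_softLower (hdiv : IsTwoOmegaDivisible S) (hO5 : AxiomO5 S)
    (hO6 : AxiomO6 S) (hO7 : AxiomO7 S) (hsep : IsLeftSoftSeparative S) {x a b : S}
    (ha : a ∈ softLower x) (hb : b ∈ softLower x) :
    ∃ c ∈ softLower x, a ≤ c ∧ b ≤ c := by
  obtain ⟨u, hu, hau, hux⟩ := ha
  obtain ⟨v, hv, hbv, hvx⟩ := hb
  obtain ⟨w, hw, hwx, haw, hbw⟩ :=
    exists_soft_upper_bound hdiv hO5 hO6 hO7 hsep hu hv hau hbv hux hvx.le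
  obtain ⟨c, hac, hbc, hcw⟩ := exists_wayBelow_join haw hbw
  obtain ⟨w', hw', hcw', hw'w⟩ := hw.exists_between hdiv hO5 hcw
  exact ⟨c, ⟨w', hw', hcw', hw'w.trans_le hwx⟩, hac.le, hbc.le⟩

/-- A directed set that is cofinally countable contains a cofinal increasing sequence. -/
theorem exists_monotone_cofinal {α : Type*} [Preorder α] {A D : Set α} (hD : D.Countable)
    (hA : A.Nonempty) (hdir : ∀ a ∈ A, ∀ b ∈ A, ∃ c ∈ A, a ≤ c ∧ b ≤ c)
    (hcof : ∀ a ∈ A, ∃ d ∈ D ∩ A, a ≤ d) :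
    ∃ p : ℕ → α, Monotone p ∧ (∀ n, p n ∈ A) ∧ ∀ a ∈ A, ∃ n, a ≤ p n := by
  obtain ⟨a₀, ha₀⟩ := hA
  obtain ⟨d₀, hd₀, -⟩ := hcof a₀ ha₀
  obtain ⟨g, hg⟩ := (hD.mono inter_subset_left).exists_eq_range ⟨d₀, hd₀⟩
  have hgA : ∀ n, g n ∈ A := fun n => (hg ▸ mem_range_self n : g n ∈ D ∩ A).2
  choose f hf using fun (n : ℕ) (v : A) => hdir v v.2 (g n) (hgA n)
  let p : ℕ → A := fun k => Nat.rec ⟨a₀, ha₀⟩ (fun n v => ⟨f n v, (hf n v).1⟩) k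
  refine ⟨fun n => (p n).1, monotone_nat_of_le_succ fun n => (hf n (p n)).2.1, fun n => (p n).2,
    fun a ha => ?_⟩
  obtain ⟨d, hd, had⟩ := hcof a ha
  rw [hg] at hd
  obtain ⟨n, rfl⟩ := hd
  exact ⟨n + 1, had.trans (hf n (p n)).2.2⟩

theorem exists_isLUB_softLower (hdiv : IsTwoOmegaDivisible S) (hO5 : AxiomO5 S)
    (hO6 : AxiomO6 S) (hO7 : AxiomO7 S) (hbase : IsCountablyBased S)
    (hsep : IsLeftSoftSeparative S) (x : S) :
    ∃ (p : ℕ → S) (s : S), Monotone p ∧ (∀ n, p n ∈ softLower x) ∧ IsLUB (range p) s ∧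
      IsLUB (softLower x) s := by
  obtain ⟨D, hD, hbase⟩ := hbase
  obtain ⟨p, hp, hpA, hcof⟩ := exists_monotone_cofinal (A := softLower x) hD
    ⟨0, 0, isStronglySoft_zero, wayBelow_zero _, wayBelow_zero _⟩
    (fun a ha b hb => exists_upper_bound_softLower hdiv hO5 hO6 hO7 hsep ha hb) <| by
      rintro a ⟨u, hu, hau, hux⟩
      obtain ⟨b, hab, hbu⟩ := hau.exists_between
      obtain ⟨d, hd, hdD, hdb⟩ := hbase b
      obtain ⟨n, hn⟩ := hab d hd b hdb le_rfl
      exact ⟨d n, ⟨hdD n, u, hu, .of_le (hdb.1 ⟨n, rfl⟩) hbu, hux⟩, hn⟩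
  obtain ⟨s, hs⟩ := IsCuSemigroup.exists_sup p hp
  refine ⟨p, s, hp, hpA, hs, fun a ha => ?_, fun b hb => hs.2 ?_⟩
  · obtain ⟨n, hn⟩ := hcof a ha
    exact hn.trans (hs.1 ⟨n, rfl⟩)
  · rintro _ ⟨n, rfl⟩
    exact hb (hpA n)

theorem IsStronglySoft.le_of_mem_upperBounds_softLower (hdiv : IsTwoOmegaDivisible S)
    (hO5 : AxiomO5 S) {u x b : S} (hu : IsStronglySoft u) (hux : u ≤ x)
    (hb : b ∈ upperBounds (softLower x)) : u ≤ b :=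
  le_of_forall_wayBelow fun a ha => by
    obtain ⟨v, hv, hav, hvu⟩ := hu.exists_between hdiv hO5 ha
    exact hb ⟨v, hv, hav, hvu.trans_le hux⟩

/-- The supremum dominates all soft elements below `x`, so it inherits the multiplicative estimate
from any core. -/
theorem isSoftCore_softPart (hdiv : IsTwoOmegaDivisible S) (hO5 : AxiomO5 S)
    (hO6 : AxiomO6 S) (hO7 : AxiomO7 S) (hbase : IsCountablyBased S)
    (hsep : IsLeftSoftSeparative S) (x : S) :
    IsLUB (softLower x) (softPart x) ∧ IsSoftCore (softPart x) x := by
  obtain ⟨p, s, hp, hpA, hps, hs⟩ := exists_isLUB_softLower hdiv hO5 hO6 hO7 hbase hsep x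
  have hσ : IsLUB (softLower x) (softPart x) := isLUB_lub ⟨s, hs⟩
  obtain rfl : s = softPart x := hs.unique hσ
  refine ⟨hσ, isStronglySoft_of_isLUB hp hps fun n => ?_, hσ.2 ?_, fun n => ?_⟩
  · obtain ⟨u, hu, hpu, hux⟩ := hpA n
    exact ⟨u, hpu.le, hu.le_of_mem_upperBounds_softLower hdiv hO5 hux.le hσ.1, hu⟩
  · rintro _ ⟨u, -, hau, hux⟩
    exact (hau.trans hux).le
  · obtain ⟨w, hw⟩ := exists_isSoftCore hdiv hO5 hO6 hO7 x
    exact (hw.2.2 n).trans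
      (nsmul_le_nsmul_right (hw.1.le_of_mem_upperBounds_softLower hdiv hO5 hw.2.1 hσ.1) _)

end Directed

end CuSgp

theorem mainTheorem9 {S : Type*} [AddCommMonoid S] [PartialOrder S] [CuSgp.IsCuSemigroup S]
    (hdiv : CuSgp.IsTwoOmegaDivisible S)
    (hO5 : CuSgp.AxiomO5 S) (hO6 : CuSgp.AxiomO6 S) (hO7 : CuSgp.AxiomO7 S)
    (e : S) (he : CuSgp.IsFull e) :
    CuSgp.IsCuSemigroup (CuSgp.soft S) ∧
    (∃ w : CuSgp.soft S,
      CuSgp.IsFull w ∧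
      CuSgp.rc S e = CuSgp.rc (CuSgp.soft S) w ∧
      (w : S) ≤ e ∧ e ≤ CuSgp.infMul (w : S) ∧
      CuSgp.rank e = CuSgp.rank (w : S)) ∧
    (CuSgp.IsCountablyBased S → CuSgp.IsLeftSoftSeparative S →
      IsLUB (CuSgp.softLower e) (CuSgp.softPart e) ∧
      ∃ hσ : CuSgp.softPart e ∈ CuSgp.soft S,
        CuSgp.IsFull (⟨CuSgp.softPart e, hσ⟩ : CuSgp.soft S) ∧
        CuSgp.rc S e = CuSgp.rc (CuSgp.soft S) ⟨CuSgp.softPart e, hσ⟩) := by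
  have hsoft := CuSgp.isCuSemigroup_soft hdiv hO5
  refine ⟨hsoft, ?_, fun hbase hsep => ?_⟩
  · obtain ⟨w, hw⟩ := CuSgp.exists_isSoftCore hdiv hO5 hO6 hO7 e
    exact ⟨⟨w, hw.1⟩, CuSgp.isFull_soft hsoft he hw.le_infMul,
      CuSgp.IsSoftCore.rc_eq hdiv hO5 hO6 hO7 he hw, hw.2.1, hw.le_infMul,
      funext fun l => (hw.map_eq l).symm⟩
  · obtain ⟨hlub, hσ⟩ := CuSgp.isSoftCore_softPart hdiv hO5 hO6 hO7 hbase hsep e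
    exact ⟨hlub, hσ.1, CuSgp.isFull_soft hsoft he hσ.le_infMul,
      CuSgp.IsSoftCore.rc_eq hdiv hO5 hO6 hO7 he hσ⟩
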